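/- Let $n\ge 0$. A Motzkin path of length $n$ is a lattice path from $(0,0)$ to $(n,0)$ with steps $U=(1,1)$, $D=(1,-1)$, $H=(1,0)$ that never goes below the $x$-axis; a Riordan path is a Motzkin path without horizontal steps on the $x$-axis. Let $S_n(321,3\bar142)$ be the set of permutations $\pi=\pi_1\cdots\pi_n$ of $[n]=\{1,\dots,n\}$ that have no $i<j<k$ with $\pi_i>\pi_j>\pi_k$, and such that for all $i<j<k$ with $\pi_j>\pi_i>\pi_k$ there is an $m$ with $i<m<j$ and $\pi_k>\pi_m$. Let $D_n(321,3\bar142)$ be the set of those elements of $S_n(321,3\bar142)$ that are derangements, i.e. $\pi_i\neq i$ for all $i$. The map $\phi$ of Chen, Deng and Yang is defined as follows. Divide the region between a Motzkin path and the $x$-axis into unit squares and triangles with horizontal unit bottom sides, and label a cell with bottom side from $(i,j)$ to $(i+1,j)$ by $i+j$. Let $P$ be a Motzkin path of length $n$ with $k$ up steps. If $k\ge 1$, let $A\to B$ be the last up step and $E\to F$ the last down step of $P$; let $h_k$ be the label of the cell containing the step $E\to F$, and $t_k$ the label of the cell (triangle, or unit square directly below the step) containing the step of $P$ that starts at $B$.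 Lowering all points of $P$ from $B$ to $E$ by one unit and keeping the other points (so that the steps $A\to B$ and $E\to F$ become horizontal) gives a Motzkin path with $k-1$ up steps, from which $(h_{k-1},t_{k-1})$ is obtained in the same way, and so on down to $(h_1,t_1)$. Put $$\phi(P)=(1\,2\,\cdots\,n)\,\sigma_1\sigma_2\cdots\sigma_k,\qquad \sigma_i=s_{h_i}s_{h_i-1}\cdots s_{t_i},$$ where $(1\,2\,\cdots\,n)$ is the identity permutation in one-line notation and $s_j$ acts on the right by interchanging the elements in positions $j$ and $j+1$. Then $\phi$ is a bijection from the set of Motzkin paths of length $n$ onto $S_n(321,3\bar142)$, and it restricts to a bijection from the set of Riordan paths of length $n$ onto $D_n(321,3\bar142)$. Consequently $|D_n(321,3\bar142)|=r_n$, where the Riordan number $r_n$ is the number of plane trees with $n$ edges in which no vertex has outdegree one. -/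

import Mathlib

namespace RiordanDerangement

/-- The three kinds of steps: up `U = (1, 1)`, down `D = (1, -1)`, horizontal `H = (1, 0)`. -/
inductive Step : Type
  | U : Step
  | D : Step
  | H : Step
  deriving DecidableEq

/-- The `y`-coordinate of the lattice path `P` (started at the origin) after its first `i` steps.
The steps of `P` are numbered from `0`, so this is the height of the step number `i`, that is, the
`y`-coordinate of its starting point `(i, height P i)`. -/
def height (P : List Step) (i : ℕ) : ℤ :=
  ((P.take i).count Step.U : ℤ) - ((P.take i).count Step.D : ℤ)

/-- Motzkin paths of length `n`: lattice paths from `(0, 0)` to `(n, 0)` with steps `U`, `D`, `H`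
that never go below the `x`-axis. -/
def motzkinPaths (n : ℕ) : Set (List Step) :=
  {P | P.length = n ∧ height P n = 0 ∧ ∀ i ≤ n, 0 ≤ height P i}

/-- Riordan paths of length `n`: Motzkin paths of length `n` without horizontal steps on the
`x`-axis. -/
def riordanPaths (n : ℕ) : Set (List Step) :=
  {P | P ∈ motzkinPaths n ∧ ∀ i, P[i]? = some Step.H → height P i ≠ 0}

/-! ### The strip decomposition of a Motzkin path -/

/-- The number (counted from `0`) of the last step of `P` that is equal to `s`;
only used when such a step exists. -/
def lastPos (s : Step) (P : List Step) : ℕ :=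
  Nat.findGreatest (fun i => P[i]? = some s) P.length

/-- The label of the cell that contains the step number `i` of `P`, for a step that is a down step,
or a horizontal step above the `x`-axis. If this step starts at `(i, y)`, then the cell is the
triangle or the unit square with bottom side from `(i, y - 1)` to `(i + 1, y - 1)`. The label of the
cell with bottom side from `(i, j)` to `(i + 1, j)` is `i + j`. -/
def cellLabel (P : List Step) (i : ℕ) : ℕ :=
  ((i : ℤ) + (height P i - 1)).toNat

/-- The head: the label of the cell that contains the last down step `E → F`. -/
def stripHead (P : List Step) : ℕ :=
  cellLabel P (lastPos Step.D P)

/-- The tail: the label of the cell that contains the step starting from the point `B`,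
where `A → B` is the last up step. -/
def stripTail (P : List Step) : ℕ :=
  cellLabel P (lastPos Step.U P + 1)

/-- Removal of the last strip of `P`. Let `A → B` be the last up step and `E → F` the last down step.
The points from `B` to `E` are moved one layer lower, and all other points stay where they are.
Thus the steps `A → B` and `E → F` become horizontal, and no other step changes. -/
def removeStrip (P : List Step) : List Step :=
  (P.set (lastPos Step.U P) Step.H).set (lastPos Step.D P) Step.H

/-- The list `[(h₁, t₁), …, (h_k, t_k)]` obtained from `k` successive removals of the last strip;
the pair `(h_k, t_k)` comes from the strip that is removed first. -/
def stripParams : ℕ → List Step → List (ℕ × ℕ)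
  | 0, _ => []
  | k + 1, P => stripParams k (removeStrip P) ++ [(stripHead P, stripTail P)]

/-- The parameters `[(h₁, t₁), …, (h_k, t_k)]` of the strip decomposition of a Motzkin path with `k`
up steps. -/
def stripDecomposition (P : List Step) : List (ℕ × ℕ) :=
  stripParams (P.count Step.U) P

/-! ### The map `φ`

A permutation `π₁ π₂ ⋯ π_n` of `[n]` is a bijection of `Fin n`, positions to values, with both
shifted from `{1, …, n}` to `{0, …, n - 1}`. -/

/-- The simple transposition `s_i`, for `1 ≤ i ≤ n - 1`. As `(π * τ) x = π (τ x)`, the permutation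
`π * s_i` arises from `π` by interchanging the elements in positions `i` and `i + 1` (counted from
`1`). Outside of the range of `i` the value is `1`, and is never used. -/
def simpleTransposition (n i : ℕ) : Equiv.Perm (Fin n) :=
  if h : 1 ≤ i ∧ i < n then
    Equiv.swap ⟨i - 1, lt_of_le_of_lt (Nat.sub_le i 1) h.2⟩ ⟨i, h.2⟩
  else 1

/-- The product `s_h s_{h-1} ⋯ s_t`. -/
def stripPerm (n h t : ℕ) : Equiv.Perm (Fin n) :=
  ((List.range' t (h + 1 - t)).reverse.map (simpleTransposition n)).prod

/-- The map `φ`: the path `P` with strip parameters `[(h₁, t₁), …, (h_k, t_k)]` is sent to the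
permutation `(1 2 ⋯ n) σ₁ σ₂ ⋯ σ_k`, where `σ_i = s_{h_i} s_{h_i - 1} ⋯ s_{t_i}`. -/
def phi (n : ℕ) (P : List Step) : Equiv.Perm (Fin n) :=
  ((stripDecomposition P).map fun p => stripPerm n p.1 p.2).prod

/-! ### Pattern avoidance -/

/-- `π` avoids the pattern `321`. -/
def Avoids321 {n : ℕ} (π : Equiv.Perm (Fin n)) : Prop :=
  ¬ ∃ i j k : Fin n, i < j ∧ j < k ∧ π i > π j ∧ π j > π k

/-- `π` avoids the barred pattern `3 1̄ 4 2`: each subsequence `π_i π_j π_k` of pattern `231` extends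
to a subsequence `π_i π_m π_j π_k` of pattern `3142`. -/
def Avoids3bar142 {n : ℕ} (π : Equiv.Perm (Fin n)) : Prop :=
  ∀ i j k : Fin n, i < j → j < k → π j > π i → π i > π k →
    ∃ m : Fin n, i < m ∧ m < j ∧ π k > π m

/-- The set `S_n(321, 3 1̄ 4 2)`. -/
def avoidingPerms (n : ℕ) : Set (Equiv.Perm (Fin n)) :=
  {π | Avoids321 π ∧ Avoids3bar142 π}

/-- The set `D_n(321, 3 1̄ 4 2)`. -/
def avoidingDerangements (n : ℕ) : Set (Equiv.Perm (Fin n)) :=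
  avoidingPerms n ∩ derangements (Fin n)

/-! ### The Riordan numbers -/

/-- Plane trees: a root with an ordered list of subtrees. -/
inductive PlaneTree : Type
  | node : List PlaneTree → PlaneTree

/-- The number of edges of a plane tree. -/
def PlaneTree.edges : PlaneTree → ℕ
  | .node cs => (cs.map fun c => c.edges + 1).sum

/-- Short bushes: plane trees in which no vertex has outdegree one. -/
inductive PlaneTree.IsShortBush : PlaneTree → Prop
  | node (cs : List PlaneTree) (hroot : cs.length ≠ 1) (hsub : ∀ c ∈ cs, c.IsShortBush) :
      PlaneTree.IsShortBush (.node cs)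

/-- The Riordan number `r_n`: the number of short bushes with `n` edges. -/
noncomputable def riordanNumber (n : ℕ) : ℕ :=
  {T : PlaneTree | T.IsShortBush ∧ T.edges = n}.ncard

end RiordanDerangement

namespace RiordanDerangement

/-! ### Heights -/

/-- The vertical component of a step. -/
def Step.rise : Step → ℤ
  | .U => 1
  | .D => -1
  | .H => 0

@[simp] theorem height_zero (P : List Step) : height P 0 = 0 := by
  simp [height]

theorem height_cons_succ (s : Step) (P : List Step) (i : ℕ) :
    height (s :: P) (i + 1) = s.rise + height P i := by
  cases s <;> simp [height, Step.rise] <;> ring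

theorem height_succ {P : List Step} {i : ℕ} {s : Step} (h : P[i]? = some s) :
    height P (i + 1) = height P i + s.rise := by
  induction P generalizing i with
  | nil => simp at h
  | cons a P ih =>
    cases i with
    | zero =>
      simp only [List.getElem?_cons_zero, Option.some.injEq] at h
      rw [height_cons_succ, h]
      simp
    | succ i =>
      rw [height_cons_succ, height_cons_succ, ih (by simpa using h)]
      ring

/-! ### Short bushes and Riordan paths -/

mutual

/-- The word of a plane tree: its edges in preorder, with `U` for the edge to a first child, `D` for
the edge to a last child and `H` for the other edges. -/
def PlaneTree.word : PlaneTree → List Step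
  | .node [] => []
  | .node (c :: cs) => Step.U :: (c.word ++ siblingsWord cs)

/-- The part of the word of a plane tree that belongs to the later siblings of a first child. -/
def siblingsWord : List PlaneTree → List Step
  | [] => []
  | [c] => Step.D :: c.word
  | c :: c' :: cs => Step.H :: (c.word ++ siblingsWord (c' :: cs))

end

theorem siblingsWord_length (cs : List PlaneTree) (h : ∀ c ∈ cs, c.word.length = c.edges) :
    (siblingsWord cs).length = (cs.map fun c => c.edges + 1).sum := by
  induction cs with
  | nil => simp [siblingsWord]
  | cons c cs ih =>
    have hc := h c (by simp)
    have ih' := ih fun c hc => h c (by simp [hc])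
    cases cs with
    | nil => simp [siblingsWord, hc]
    | cons c' cs =>
      simp only [siblingsWord, List.length_cons, List.length_append, ih', hc, List.map_cons,
        List.sum_cons]
      ring

theorem PlaneTree.IsShortBush.word_length {T : PlaneTree} (hT : T.IsShortBush) :
    T.word.length = T.edges := by
  induction hT with
  | node cs hroot hsub ih =>
    rw [PlaneTree.edges]
    cases cs with
    | nil => simp [PlaneTree.word]
    | cons c cs =>
      simp only [PlaneTree.word, List.length_cons, List.length_append, List.map_cons, List.sum_cons,
        siblingsWord_length cs fun c hc => ih c (by simp [hc]), ih c (by simp)]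
      ring

theorem head?_siblingsWord_append_ne (cs : List PlaneTree) (hcs : cs ≠ []) (l : List Step) :
    (siblingsWord cs ++ l).head? ≠ some Step.U := by
  match cs, hcs with
  | [c], _ => simp [siblingsWord]
  | c :: c' :: cs, _ => simp [siblingsWord]

theorem siblingsWord_append_inj (cs cs' : List PlaneTree) (hcs : cs ≠ []) (hcs' : cs' ≠ [])
    (hsub' : ∀ c ∈ cs', c.IsShortBush)
    (ih : ∀ c ∈ cs, ∀ T' : PlaneTree, T'.IsShortBush → ∀ l l' : List Step,
      l.head? ≠ some Step.U → l'.head? ≠ some Step.U → c.word ++ l = T'.word ++ l' →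
      c = T' ∧ l = l')
    (l l' : List Step) (hl : l.head? ≠ some Step.U) (hl' : l'.head? ≠ some Step.U)
    (h : siblingsWord cs ++ l = siblingsWord cs' ++ l') : cs = cs' ∧ l = l' := by
  induction cs generalizing cs' with
  | nil => exact absurd rfl hcs
  | cons c cs ihcs =>
    match cs, cs', hcs' with
    | [], [d], _ =>
      simp only [siblingsWord, List.cons_append, List.cons.injEq, true_and] at h
      obtain ⟨rfl, h'⟩ := ih c (by simp) d (hsub' d (by simp)) l l' hl hl' h
      exact ⟨rfl, h'⟩
    | [], d :: d' :: ds, _ => simp [siblingsWord] at h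
    | c' :: cs, [d], _ => simp [siblingsWord] at h
    | c' :: cs, d :: d' :: ds, _ =>
      simp only [siblingsWord, List.cons_append, List.cons.injEq, true_and, List.append_assoc] at h
      obtain ⟨rfl, h'⟩ := ih c (by simp) d (hsub' d (by simp)) _ _
        (head?_siblingsWord_append_ne _ (by simp) _) (head?_siblingsWord_append_ne _ (by simp) _) h
      obtain ⟨h1, h2⟩ := ihcs (d' :: ds) (by simp) (by simp)
        (fun x hx => hsub' x (List.mem_cons_of_mem _ hx))
        (fun x hx => ih x (List.mem_cons_of_mem _ hx)) h'
      exact ⟨by rw [h1], h2⟩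

theorem PlaneTree.IsShortBush.word_append_inj {T : PlaneTree} (hT : T.IsShortBush) :
    ∀ T' : PlaneTree, T'.IsShortBush → ∀ l l' : List Step, l.head? ≠ some Step.U →
      l'.head? ≠ some Step.U → T.word ++ l = T'.word ++ l' → T = T' ∧ l = l' := by
  induction hT with
  | node cs hroot hsub ih =>
    intro T' hT' l l' hl hl' h
    obtain ⟨cs', hroot', hsub'⟩ := hT'
    match cs, cs' with
    | [], [] => exact ⟨rfl, by simpa [PlaneTree.word] using h⟩
    | [], d :: ds => simp_all [PlaneTree.word]
    | c :: cs, [] =>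
      have h' : (PlaneTree.node (c :: cs)).word ++ l = l' := by simpa [PlaneTree.word] using h
      simp [← h', PlaneTree.word] at hl'
    | c :: cs, d :: ds =>
      have hcs : cs ≠ [] := by rintro rfl; simp at hroot
      have hds : ds ≠ [] := by rintro rfl; simp at hroot'
      simp only [PlaneTree.word, List.cons_append, List.cons.injEq, true_and, List.append_assoc]
        at h
      obtain ⟨rfl, h'⟩ := ih c (by simp) d (hsub' d (by simp)) _ _
        (head?_siblingsWord_append_ne _ hcs _) (head?_siblingsWord_append_ne _ hds _) h
      obtain ⟨rfl, h2⟩ := siblingsWord_append_inj cs ds hcs hds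
        (fun x hx => hsub' x (List.mem_cons_of_mem _ hx))
        (fun x hx => ih x (List.mem_cons_of_mem _ hx)) l l' hl hl' h'
      exact ⟨rfl, h2⟩

/-- The lattice paths from height `h` down to height `0` that never go below the `x`-axis and have
no horizontal step on it. -/
def IsRiordanFrom : ℕ → List Step → Prop
  | h, [] => h = 0
  | h, Step.U :: P => IsRiordanFrom (h + 1) P
  | h + 1, Step.D :: P => IsRiordanFrom h P
  | h + 1, Step.H :: P => IsRiordanFrom (h + 1) P
  | 0, Step.D :: _ => False
  | 0, Step.H :: _ => False

theorem isRiordanFrom_iff (h : ℕ) (P : List Step) :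
    IsRiordanFrom h P ↔ h + height P P.length = 0 ∧ (∀ i ≤ P.length, 0 ≤ h + height P i) ∧
      ∀ i, P[i]? = some Step.H → h + height P i ≠ 0 := by
  induction P generalizing h with
  | nil =>
    simp only [IsRiordanFrom, List.length_nil, height_zero]
    constructor
    · rintro rfl
      simp
    · rintro ⟨h0, -⟩
      omega
  | cons s P ih =>
    have key : ∀ g : ℕ, (g : ℤ) = h + s.rise → (s = Step.H → h ≠ 0) →
        (IsRiordanFrom g P ↔ h + height (s :: P) (s :: P).length = 0 ∧
          (∀ i ≤ (s :: P).length, 0 ≤ h + height (s :: P) i) ∧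
          ∀ i, (s :: P)[i]? = some Step.H → h + height (s :: P) i ≠ 0) := by
      intro g hg hs
      rw [ih, List.length_cons, height_cons_succ, hg]
      refine and_congr (by rw [add_assoc]) (and_congr ?_ ?_)
      · constructor
        · intro H i hi
          cases i with
          | zero => simp
          | succ i =>
            rw [height_cons_succ, ← add_assoc]
            exact H i (by omega)
        · intro H i hi
          rw [add_assoc, ← height_cons_succ]
          exact H (i + 1) (by omega)
      · constructor
        · intro H i hi
          cases i with
          | zero =>
            simp only [List.getElem?_cons_zero, Option.some.injEq] at hi
            simpa using hs hi
          | succ i =>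
            rw [height_cons_succ, ← add_assoc]
            exact H i (by simpa using hi)
        · intro H i hi
          rw [add_assoc, ← height_cons_succ]
          exact H (i + 1) (by simpa using hi)
    cases s with
    | U =>
      rw [IsRiordanFrom]
      exact key (h + 1) (by simp [Step.rise]) (by simp)
    | D =>
      cases h with
      | zero =>
        simp only [IsRiordanFrom, false_iff]
        rintro ⟨-, H, -⟩
        have := H 1 (by simp)
        rw [← zero_add 1, height_cons_succ] at this
        simp [Step.rise] at this
      | succ h =>
        rw [IsRiordanFrom]
        exact key h (by simp [Step.rise]) (by simp)
    | H =>
      cases h with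
      | zero =>
        simp only [IsRiordanFrom, false_iff]
        rintro ⟨-, -, H⟩
        exact H 0 (by simp) (by simp)
      | succ h =>
        rw [IsRiordanFrom]
        exact key (h + 1) (by simp [Step.rise]) (by simp)

theorem mem_riordanPaths_iff {n : ℕ} {P : List Step} :
    P ∈ riordanPaths n ↔ P.length = n ∧ IsRiordanFrom 0 P := by
  rw [isRiordanFrom_iff]
  simp only [riordanPaths, motzkinPaths, Set.mem_ofPred_eq, Nat.cast_zero, zero_add]
  constructor
  · rintro ⟨⟨rfl, h1, h2⟩, h3⟩
    exact ⟨rfl, h1, h2, h3⟩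
  · rintro ⟨rfl, h1, h2, h3⟩
    exact ⟨⟨rfl, h1, h2⟩, h3⟩

theorem IsRiordanFrom.siblingsWord_append {h : ℕ} (cs : List PlaneTree) (hcs : cs ≠ [])
    (ih : ∀ c ∈ cs, ∀ h l, IsRiordanFrom h l → IsRiordanFrom h (c.word ++ l)) {l : List Step}
    (hl : IsRiordanFrom h l) : IsRiordanFrom (h + 1) (siblingsWord cs ++ l) := by
  induction cs with
  | nil => exact absurd rfl hcs
  | cons c cs ihcs =>
    match cs with
    | [] => exact ih c (by simp) _ _ hl
    | c' :: cs =>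
      simp only [siblingsWord, List.cons_append, List.append_assoc, IsRiordanFrom]
      exact ih c (by simp) _ _
        (ihcs (by simp) fun x hx => ih x (List.mem_cons_of_mem _ hx))

theorem PlaneTree.IsShortBush.isRiordanFrom_word_append {T : PlaneTree} (hT : T.IsShortBush) :
    ∀ h l, IsRiordanFrom h l → IsRiordanFrom h (T.word ++ l) := by
  induction hT with
  | node cs hroot hsub ih =>
    intro h l hl
    match cs with
    | [] => simpa [PlaneTree.word] using hl
    | c :: cs =>
      have hcs : cs ≠ [] := by rintro rfl; simp at hroot
      simp only [PlaneTree.word, List.cons_append, List.append_assoc, IsRiordanFrom]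
      exact ih c (by simp) _ _
        (hl.siblingsWord_append cs hcs fun x hx => ih x (List.mem_cons_of_mem _ hx))

theorem IsRiordanFrom.exists_word_append_aux (N : ℕ) :
    (∀ h Q, Q.length ≤ N → IsRiordanFrom h Q → ∃ (T : PlaneTree) (l : List Step), T.IsShortBush ∧
      Q = T.word ++ l ∧ IsRiordanFrom h l ∧ l.head? ≠ some Step.U) ∧
    (∀ h Q, Q.length ≤ N → IsRiordanFrom (h + 1) Q →
      ∃ (c : PlaneTree) (cs : List PlaneTree) (l : List Step), cs ≠ [] ∧
        (∀ x ∈ c :: cs, x.IsShortBush) ∧ Q = c.word ++ (siblingsWord cs ++ l) ∧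
        IsRiordanFrom h l ∧ l.head? ≠ some Step.U) := by
  have leaf : (PlaneTree.node []).IsShortBush := .node [] (by simp) (by simp)
  induction N with
  | zero =>
    refine ⟨fun h Q hQ hR => ?_, fun h Q hQ hR => ?_⟩
    · obtain rfl : Q = [] := by simpa using hQ
      exact ⟨.node [], [], leaf, by simp [PlaneTree.word], hR, by simp⟩
    · obtain rfl : Q = [] := by simpa using hQ
      simp [IsRiordanFrom] at hR
  | succ N ih =>
    have hA : ∀ h Q, Q.length ≤ N + 1 → IsRiordanFrom h Q → ∃ (T : PlaneTree) (l : List Step),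
        T.IsShortBush ∧ Q = T.word ++ l ∧ IsRiordanFrom h l ∧ l.head? ≠ some Step.U := by
      intro h Q hQ hR
      match Q with
      | [] => exact ⟨.node [], [], leaf, by simp [PlaneTree.word], hR, by simp⟩
      | Step.D :: Q => exact ⟨.node [], _, leaf, by simp [PlaneTree.word], hR, by simp⟩
      | Step.H :: Q => exact ⟨.node [], _, leaf, by simp [PlaneTree.word], hR, by simp⟩
      | Step.U :: Q =>
        rw [IsRiordanFrom] at hR
        obtain ⟨c, cs, l, hcs, hsub, rfl, hl, hU⟩ := ih.2 h Q (by simpa using hQ) hR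
        exact ⟨.node (c :: cs), l, .node _ (by simpa using hcs) hsub, by simp [PlaneTree.word], hl,
          hU⟩
    refine ⟨hA, fun h Q hQ hR => ?_⟩
    obtain ⟨c, l, hc, rfl, hl, hU⟩ := hA _ Q hQ hR
    rw [List.length_append] at hQ
    match l with
    | [] => simp [IsRiordanFrom] at hl
    | Step.U :: l => simp at hU
    | Step.D :: l =>
      rw [IsRiordanFrom] at hl
      rw [List.length_cons] at hQ
      obtain ⟨d, l, hd, rfl, hl, hU⟩ := ih.1 h l (by omega) hl
      exact ⟨c, [d], l, by simp, by simp [hc, hd], by simp [siblingsWord], hl, hU⟩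
    | Step.H :: l =>
      rw [IsRiordanFrom] at hl
      rw [List.length_cons] at hQ
      obtain ⟨d, ds, l, hds, hsub, rfl, hl, hU⟩ := ih.2 h l (by omega) hl
      refine ⟨c, d :: ds, l, by simp, ?_, ?_, hl, hU⟩
      · intro x hx
        rcases List.mem_cons.1 hx with rfl | hx
        · exact hc
        · exact hsub x hx
      · match ds, hds with
        | e :: es, _ => simp [siblingsWord]

theorem IsRiordanFrom.exists_word_eq {P : List Step} (hP : IsRiordanFrom 0 P) :
    ∃ T : PlaneTree, T.IsShortBush ∧ T.word = P := by
  obtain ⟨T, l, hT, rfl, hl, hU⟩ := (IsRiordanFrom.exists_word_append_aux P.length).1 0 P le_rfl hP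
  match l with
  | [] => exact ⟨T, hT, by simp⟩
  | Step.U :: l => simp at hU
  | Step.D :: l => simp [IsRiordanFrom] at hl
  | Step.H :: l => simp [IsRiordanFrom] at hl

theorem bijOn_word (n : ℕ) :
    Set.BijOn PlaneTree.word {T : PlaneTree | T.IsShortBush ∧ T.edges = n} (riordanPaths n) := by
  refine ⟨?_, ?_, ?_⟩
  · rintro T ⟨hT, rfl⟩
    rw [mem_riordanPaths_iff]
    exact ⟨hT.word_length, by simpa using hT.isRiordanFrom_word_append 0 [] rfl⟩
  · rintro T ⟨hT, -⟩ T' ⟨hT', -⟩ h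
    exact (hT.word_append_inj T' hT' [] [] (by simp) (by simp) (by simpa using h)).1
  · intro P hP
    rw [mem_riordanPaths_iff] at hP
    obtain ⟨T, hT, rfl⟩ := hP.2.exists_word_eq
    exact ⟨T, ⟨hT, hT.word_length.symm.trans hP.1⟩, rfl⟩

theorem ncard_riordanPaths (n : ℕ) : (riordanPaths n).ncard = riordanNumber n := by
  rw [riordanNumber, ← (bijOn_word n).image_eq, (bijOn_word n).injOn.ncard_image]

theorem height_le_of_forall_ne_D {P : List Step} {i j : ℕ} (hij : i ≤ j) (hj : j ≤ P.length)
    (h : ∀ k, i ≤ k → k < j → P[k]? ≠ some Step.D) : height P i ≤ height P j := by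
  induction j, hij using Nat.le_induction with
  | base => exact le_rfl
  | succ j hij ih =>
    have hs : P[j]? = some P[j] := List.getElem?_eq_getElem (by omega)
    have hD := h j hij (by omega)
    rw [height_succ hs]
    have := ih (by omega) fun k hk hk' => h k hk (by omega)
    rw [hs] at hD
    cases hP : P[j] <;> simp_all [Step.rise]; omega

theorem height_le_of_forall_ne_U {P : List Step} {i j : ℕ} (hij : i ≤ j) (hj : j ≤ P.length)
    (h : ∀ k, i ≤ k → k < j → P[k]? ≠ some Step.U) : height P j ≤ height P i := by
  induction j, hij using Nat.le_induction with
  | base => exact le_rfl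
  | succ j hij ih =>
    have hs : P[j]? = some P[j] := List.getElem?_eq_getElem (by omega)
    have hU := h j hij (by omega)
    rw [height_succ hs]
    have := ih (by omega) fun k hk hk' => h k hk (by omega)
    rw [hs] at hU
    cases hP : P[j] <;> simp_all [Step.rise]; omega

theorem add_height_le {P : List Step} {i j : ℕ} (hij : i ≤ j) (hj : j ≤ P.length) :
    i + height P i ≤ j + height P j := by
  induction j, hij using Nat.le_induction with
  | base => exact le_rfl
  | succ j hij ih =>
    have hs : P[j]? = some P[j] := List.getElem?_eq_getElem (by omega)
    rw [height_succ hs]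
    have := ih (by omega)
    cases P[j] <;> simp [Step.rise] <;> omega

theorem lastPos_spec {s : Step} {P : List Step} {i : ℕ} (h : P[i]? = some s) :
    P[lastPos s P]? = some s ∧ i ≤ lastPos s P := by
  have hi : i ≤ P.length := (List.getElem?_eq_some_iff.1 h).1.le
  exact ⟨Nat.findGreatest_spec (P := fun i => P[i]? = some s) hi h, Nat.le_findGreatest hi h⟩

theorem lastPos_strip {n : ℕ} {P : List Step} (hP : P ∈ motzkinPaths n)
    (hU : 0 < P.count Step.U) :
    P[lastPos Step.U P]? = some Step.U ∧ P[lastPos Step.D P]? = some Step.D ∧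
      lastPos Step.U P < lastPos Step.D P ∧ lastPos Step.D P < n ∧
      height P (lastPos Step.D P) = 1 ∧
      (∀ i, lastPos Step.U P < i → i ≤ lastPos Step.D P → 1 ≤ height P i) ∧
      (∀ i, lastPos Step.U P < i → P[i]? ≠ some Step.U) ∧
      (∀ i, lastPos Step.D P < i → P[i]? ≠ some Step.D) := by
  obtain ⟨rfl, h0, hnn⟩ := hP
  obtain ⟨i, hi⟩ := List.mem_iff_getElem?.1 (List.count_pos_iff.1 hU)
  have hu := (lastPos_spec hi).1
  have hu' : ∀ i, lastPos Step.U P < i → P[i]? ≠ some Step.U := fun i hi h =>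
    absurd (lastPos_spec h).2 (by omega)
  have hd' : ∀ i, lastPos Step.D P < i → P[i]? ≠ some Step.D := fun i hi h =>
    absurd (lastPos_spec h).2 (by omega)
  set u := lastPos Step.U P
  have hun : u < P.length := (List.getElem?_eq_some_iff.1 hu).1
  have hu1 : 1 ≤ height P (u + 1) := by
    rw [height_succ hu]
    have := hnn u hun.le
    simp only [Step.rise]
    omega
  obtain ⟨j, hj, -, hjD⟩ : ∃ j, u + 1 ≤ j ∧ j < P.length ∧ P[j]? = some Step.D := by
    by_contra! H
    have := height_le_of_forall_ne_D (P := P) (i := u + 1) (by omega) le_rfl H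
    omega
  obtain ⟨hd, hjd⟩ := lastPos_spec hjD
  set d := lastPos Step.D P
  have hdn : d < P.length := (List.getElem?_eq_some_iff.1 hd).1
  have hd1 : height P d = 1 := by
    have h1 := height_succ hd
    have h2 := height_le_of_forall_ne_D (P := P) (i := d + 1) (by omega) le_rfl
      fun k hk _ => hd' k (by omega)
    have h3 := hnn (d + 1) (by omega)
    simp only [Step.rise] at h1
    omega
  refine ⟨hu, hd, by omega, hdn, hd1, fun i hi hi' => ?_, hu', hd'⟩
  rw [← hd1]
  exact height_le_of_forall_ne_U hi' hdn.le fun k hk _ => hu' k (by omega)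

theorem getElem?_removeStrip {n : ℕ} {P : List Step} (hP : P ∈ motzkinPaths n)
    (hU : 0 < P.count Step.U) (i : ℕ) :
    (removeStrip P)[i]? =
      if i = lastPos Step.U P ∨ i = lastPos Step.D P then some Step.H else P[i]? := by
  obtain ⟨hu, hd, hud, hdn, -⟩ := lastPos_strip hP hU
  obtain ⟨rfl, -⟩ := hP
  rw [removeStrip, List.getElem?_set, List.getElem?_set, List.length_set]
  grind

theorem length_removeStrip (P : List Step) : (removeStrip P).length = P.length := by
  simp [removeStrip]

theorem height_removeStrip {n : ℕ} {P : List Step} (hP : P ∈ motzkinPaths n)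
    (hU : 0 < P.count Step.U) {i : ℕ} (hi : i ≤ n) :
    height (removeStrip P) i =
      height P i - if lastPos Step.U P < i ∧ i ≤ lastPos Step.D P then 1 else 0 := by
  have hQ := getElem?_removeStrip hP hU
  obtain ⟨hu, hd, hud, -⟩ := lastPos_strip hP hU
  obtain ⟨rfl, -⟩ := hP
  induction i with
  | zero => simp
  | succ i ih =>
    obtain ⟨s, hs⟩ : ∃ s, P[i]? = some s := ⟨_, List.getElem?_eq_getElem (by omega)⟩
    have hQi := hQ i
    have ih := ih (by omega)
    rw [height_succ hs]
    by_cases h1 : i = lastPos Step.U P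
    · rw [if_pos (Or.inl h1)] at hQi
      obtain rfl : s = Step.U := by simpa [h1, hu] using hs.symm
      rw [height_succ hQi, ih, if_neg (by omega), if_pos (by omega)]
      simp [Step.rise]
    · by_cases h2 : i = lastPos Step.D P
      · rw [if_pos (Or.inr h2)] at hQi
        obtain rfl : s = Step.D := by simpa [h2, hd] using hs.symm
        rw [height_succ hQi, ih, if_pos (by omega), if_neg (by omega)]
        simp only [Step.rise]
        ring
      · rw [if_neg (by omega), hs] at hQi
        rw [height_succ hQi, ih]
        split_ifs <;> omega

theorem removeStrip_mem_motzkinPaths {n : ℕ} {P : List Step} (hP : P ∈ motzkinPaths n)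
    (hU : 0 < P.count Step.U) : removeStrip P ∈ motzkinPaths n := by
  obtain ⟨hu, hd, hud, hdn, -, hpos, -⟩ := lastPos_strip hP hU
  refine ⟨(length_removeStrip P).trans hP.1, ?_, fun i hi => ?_⟩
  · rw [height_removeStrip hP hU le_rfl, hP.2.1, if_neg (by omega)]
    simp
  · rw [height_removeStrip hP hU hi]
    have := hP.2.2 i hi
    split_ifs with h
    · have := hpos i h.1 h.2
      omega
    · omega

theorem count_removeStrip {n : ℕ} {P : List Step} (hP : P ∈ motzkinPaths n)
    (hU : 0 < P.count Step.U) : (removeStrip P).count Step.U + 1 = P.count Step.U := by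
  obtain ⟨hu, hd, hud, hdn, -⟩ := lastPos_strip hP hU
  obtain ⟨hun, hu⟩ := List.getElem?_eq_some_iff.1 hu
  obtain ⟨hdn', hd⟩ := List.getElem?_eq_some_iff.1 hd
  rw [removeStrip, List.count_set (by simpa using hdn'), List.count_set hun,
    List.getElem_set_ne (by omega), hu, hd]
  simp
  omega

/-- The excedance positions that belong to a Motzkin path. -/
def excedancePositions (P : List Step) : Set ℕ :=
  {e | ∃ u, P[u]? = some Step.U ∧ (e : ℤ) = u + height P u}

theorem mem_excedancePositions_iff {n : ℕ} {P : List Step} (hP : P ∈ motzkinPaths n)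
    (hU : 0 < P.count Step.U) {e : ℕ}
    (he : (e : ℤ) = lastPos Step.U P + height P (lastPos Step.U P)) (x : ℕ) :
    x ∈ excedancePositions P ↔ x = e ∨ x ∈ excedancePositions (removeStrip P) := by
  have hQ := getElem?_removeStrip hP hU
  have hH := fun i => height_removeStrip hP hU (i := i)
  obtain ⟨hu, hd, hud, hdn, -, -, hu', -⟩ := lastPos_strip hP hU
  constructor
  · rintro ⟨v, hv, hx⟩
    rcases lt_trichotomy v (lastPos Step.U P) with h | rfl | h
    · refine Or.inr ⟨v, ?_, ?_⟩
      · rw [hQ, if_neg (by omega), hv]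
      · rw [hH v (by omega), if_neg (by omega), hx]
        simp
    · left
      omega
    · exact absurd hv (hu' v h)
  · rintro (rfl | ⟨v, hv, hx⟩)
    · exact ⟨_, hu, he⟩
    · rw [hQ] at hv
      split_ifs at hv with h
      · simp at hv
      have hvu : v < lastPos Step.U P := by
        by_contra h'
        exact hu' v (by omega) hv
      refine ⟨v, hv, ?_⟩
      rw [hx, hH v (by omega), if_neg (by omega)]
      simp

theorem lt_of_mem_excedancePositions_removeStrip {n : ℕ} {P : List Step} (hP : P ∈ motzkinPaths n)
    (hU : 0 < P.count Step.U) {e : ℕ}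
    (he : (e : ℤ) = lastPos Step.U P + height P (lastPos Step.U P)) {x : ℕ}
    (hx : x ∈ excedancePositions (removeStrip P)) : x < e := by
  have hQ := getElem?_removeStrip hP hU
  have hH := fun i => height_removeStrip hP hU (i := i)
  obtain ⟨hu, hd, hud, hdn, -, -, hu', -⟩ := lastPos_strip hP hU
  obtain ⟨v, hv, hx⟩ := hx
  rw [hQ] at hv
  split_ifs at hv with h
  · simp at hv
  have hvu : v < lastPos Step.U P := by
    by_contra h'
    exact hu' v (by omega) hv
  rw [hH v (by omega), if_neg (by omega)] at hx
  have h1 := height_succ hv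
  have h2 := add_height_le (P := P) (i := v + 1) (j := lastPos Step.U P) (by omega)
    (by rw [hP.1]; omega)
  simp only [Step.rise] at h1
  push_cast at h2
  omega

theorem stripHead_eq {n : ℕ} {P : List Step} (hP : P ∈ motzkinPaths n)
    (hU : 0 < P.count Step.U) : stripHead P = lastPos Step.D P := by
  obtain ⟨-, -, -, -, h1, -⟩ := lastPos_strip hP hU
  simp [stripHead, cellLabel, h1]

theorem stripTail_eq {n : ℕ} {P : List Step} (hP : P ∈ motzkinPaths n)
    (hU : 0 < P.count Step.U) {e : ℕ}
    (he : (e : ℤ) = lastPos Step.U P + height P (lastPos Step.U P)) : stripTail P = e + 1 := by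
  obtain ⟨hu, -⟩ := lastPos_strip hP hU
  rw [stripTail, cellLabel, height_succ hu]
  simp only [Step.rise]
  omega

theorem lt_lastPos_D {n : ℕ} {P : List Step} (hP : P ∈ motzkinPaths n)
    (hU : 0 < P.count Step.U) {e : ℕ}
    (he : (e : ℤ) = lastPos Step.U P + height P (lastPos Step.U P)) : e < lastPos Step.D P := by
  obtain ⟨hu, hd, hud, hdn, hd1, -⟩ := lastPos_strip hP hU
  have h1 := height_succ hu
  have h2 := add_height_le (P := P) (i := lastPos Step.U P + 1) (j := lastPos Step.D P) (by omega)
    (by rw [hP.1]; omega)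
  simp only [Step.rise] at h1
  push_cast at h2
  omega

/-- The step number `i` is horizontal and lies on the `x`-axis. -/
def IsGroundStep (P : List Step) (i : ℕ) : Prop :=
  P[i]? = some Step.H ∧ height P i = 0

theorem isGroundStep_removeStrip_lastPos_D {n : ℕ} {P : List Step} (hP : P ∈ motzkinPaths n)
    (hU : 0 < P.count Step.U) : IsGroundStep (removeStrip P) (lastPos Step.D P) := by
  obtain ⟨hu, hd, hud, hdn, hd1, -⟩ := lastPos_strip hP hU
  constructor
  · rw [getElem?_removeStrip hP hU, if_pos (by omega)]
  · rw [height_removeStrip hP hU (by omega), if_pos (by omega), hd1]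
    simp

theorem isGroundStep_iff {n : ℕ} {P : List Step} (hP : P ∈ motzkinPaths n)
    (hU : 0 < P.count Step.U) {e : ℕ}
    (he : (e : ℤ) = lastPos Step.U P + height P (lastPos Step.U P)) (x : ℕ) (hx : x < n) :
    IsGroundStep P x ↔ IsGroundStep (removeStrip P) x ∧ ¬ (e ≤ x ∧ x ≤ lastPos Step.D P) := by
  have hxQ := getElem?_removeStrip hP hU x
  have hxH := height_removeStrip hP hU hx.le
  obtain ⟨hu, hd, hud, hdn, hd1, hpos, -⟩ := lastPos_strip hP hU
  have hnn := hP.2.2 (lastPos Step.U P) (by omega)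
  have huH := height_removeStrip hP hU (i := lastPos Step.U P) (by omega)
  rw [if_neg (by omega)] at huH
  constructor
  · rintro ⟨h1, h2⟩
    have h3 : ¬ (lastPos Step.U P < x ∧ x ≤ lastPos Step.D P) := fun h => by
      have := hpos x h.1 h.2
      omega
    have h4 : x ≠ lastPos Step.U P := by
      rintro rfl
      simp [hu] at h1
    refine ⟨⟨?_, ?_⟩, by omega⟩
    · rw [hxQ, if_neg (by omega), h1]
    · rw [hxH, if_neg h3, h2]
      simp
  · rintro ⟨⟨h1, h2⟩, h3⟩
    have h4 : ¬ (lastPos Step.U P ≤ x ∧ x ≤ lastPos Step.D P) := by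
      rintro ⟨h4, h5⟩
      have := add_height_le (P := removeStrip P) (j := x) h4
        (by rw [length_removeStrip, hP.1]; omega)
      omega
    rw [hxQ, if_neg (by omega)] at h1
    rw [hxH, if_neg (by omega)] at h2
    exact ⟨h1, by simpa using h2⟩

/-! ### The permutation of a Motzkin path -/

theorem simpleTransposition_apply {n i : ℕ} (h1 : 1 ≤ i) (hi : i < n) (x : Fin n) :
    (simpleTransposition n i x : ℕ) =
      if (x : ℕ) = i - 1 then i else if (x : ℕ) = i then i - 1 else x := by
  rw [simpleTransposition, dif_pos ⟨h1, hi⟩, Equiv.swap_apply_def]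
  simp only [Fin.ext_iff]
  split_ifs <;> rfl

theorem stripPerm_apply {n h e : ℕ} (he : e < h) (hn : h < n) (x : Fin n) :
    (stripPerm n h (e + 1) x : ℕ) =
      if (x : ℕ) = e then h else if e < x ∧ x ≤ h then x - 1 else (x : ℕ) := by
  obtain ⟨m, rfl⟩ : ∃ m, h = e + m := ⟨h - e, by omega⟩
  rw [stripPerm, show e + m + 1 - (e + 1) = m by omega]
  clear he
  induction m generalizing x with
  | zero =>
    simp only [List.range'_zero, List.reverse_nil, List.map_nil, List.prod_nil,
      Equiv.Perm.coe_one, id_eq]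
    split_ifs <;> omega
  | succ m ih =>
    have ih := ih x (by omega)
    rw [List.range'_concat, List.reverse_append, List.map_append, List.prod_append]
    simp only [List.reverse_singleton, List.map_cons, List.map_nil, List.prod_singleton,
      Equiv.Perm.mul_apply]
    rw [simpleTransposition_apply (by omega) (by omega), ih]
    split_ifs <;> omega

/-- The properties that determine the permutation `π` that belongs to the Motzkin path `P`. -/
structure IsPermOf {n : ℕ} (P : List Step) (π : Equiv.Perm (Fin n)) : Prop where
  lt_apply_iff : ∀ x, x < π x ↔ (x : ℕ) ∈ excedancePositions P
  down_iff : ∀ v, P[v]? = some Step.D ↔ ∃ x, x < π x ∧ (π x : ℕ) = v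
  strictMonoOn_excedances : StrictMonoOn π {x | x < π x}
  strictMonoOn_nonexcedances : StrictMonoOn π {x | π x ≤ x}
  apply_eq_iff : ∀ x, π x = x ↔ IsGroundStep P x

theorem isPermOf_one {n : ℕ} {P : List Step} (hP : P ∈ motzkinPaths n)
    (hU : P.count Step.U = 0) : IsPermOf P (1 : Equiv.Perm (Fin n)) := by
  have hD : P.count Step.D = 0 := by
    have := hP.2.1
    rw [height, ← hP.1, List.take_length] at this
    omega
  have hU' : ∀ i, P[i]? ≠ some Step.U := fun i h =>
    List.count_eq_zero.1 hU (List.mem_of_getElem? h)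
  have hD' : ∀ i, P[i]? ≠ some Step.D := fun i h =>
    List.count_eq_zero.1 hD (List.mem_of_getElem? h)
  refine ⟨fun x => ?_, fun v => ?_, fun x _ y _ h => h, fun x _ y _ h => h, fun x => ?_⟩
  · simp [excedancePositions, hU']
  · simp [hD']
  · simp only [Equiv.Perm.coe_one, id_eq, true_iff]
    have hx : (x : ℕ) < P.length := by
      rw [hP.1]
      exact x.2
    have hs : P[(x : ℕ)]? = some P[(x : ℕ)] := List.getElem?_eq_getElem hx
    constructor
    · have h1 := hU' x
      have h2 := hD' x
      rw [hs] at h1 h2 ⊢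
      cases h : P[(x : ℕ)] <;> simp_all
    · have h1 := height_le_of_forall_ne_D (Nat.zero_le x) hx.le fun k _ _ => hD' k
      have h2 := height_le_of_forall_ne_U (Nat.zero_le x) hx.le fun k _ _ => hU' k
      rw [height_zero] at h1 h2
      omega

theorem IsPermOf.mul_stripPerm {n : ℕ} {P : List Step} (hP : P ∈ motzkinPaths n)
    (hU : 0 < P.count Step.U) {ρ : Equiv.Perm (Fin n)} (hρ : IsPermOf (removeStrip P) ρ) :
    IsPermOf P (ρ * stripPerm n (stripHead P) (stripTail P)) := by
  obtain ⟨hu, hd, hud, hdn, hd1, hpos, hu', hd'⟩ := lastPos_strip hP hU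
  obtain ⟨e, he⟩ : ∃ e : ℕ, (e : ℤ) = lastPos Step.U P + height P (lastPos Step.U P) :=
    ⟨_, Int.toNat_of_nonneg (by have := hP.2.2 (lastPos Step.U P) (by omega); omega)⟩
  have hed := lt_lastPos_D hP hU he
  have hE := mem_excedancePositions_iff hP hU he
  have hE' := fun x => lt_of_mem_excedancePositions_removeStrip hP hU he (x := x)
  have hG := isGroundStep_iff hP hU he
  have hGd := isGroundStep_removeStrip_lastPos_D hP hU
  have hQ := getElem?_removeStrip hP hU
  rw [stripHead_eq hP hU, stripTail_eq hP hU he]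
  set d := lastPos Step.D P
  have hσ := stripPerm_apply hed hdn
  set σ := stripPerm n d (e + 1)
  have hQD : ∀ v, P[v]? = some Step.D ↔ v = d ∨ (removeStrip P)[v]? = some Step.D := by
    intro v
    rw [hQ]
    constructor
    · intro h
      by_cases hvd : v = d
      · exact Or.inl hvd
      · right
        rw [if_neg, h]
        rintro (rfl | h')
        · simp [hu] at h
        · exact hvd h'
    · rintro (rfl | h)
      · exact hd
      · split_ifs at h
        · simp at h
        · exact h
  have hQD' : ∀ v, (removeStrip P)[v]? = some Step.D → v < d := by
    intro v hv
    by_contra h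
    rw [hQ] at hv
    split_ifs at hv
    · simp at hv
    exact hd' v (by omega) hv
  have hρd : ∀ x : Fin n, (x : ℕ) = d → ρ x = x := by
    intro x hx
    rw [hρ.apply_eq_iff, hx]
    exact hGd
  have hπ : ∀ x, (ρ * σ) x = ρ (σ x) := fun _ => rfl
  have hρE : ∀ x, x < ρ x → (x : ℕ) < e := fun x hx => hE' x ((hρ.lt_apply_iff x).1 hx)
  have hlt : ∀ x : Fin n, (x : ℕ) < e → ρ (σ x) = ρ x := by
    intro x hx
    congr 1
    ext
    rw [hσ, if_neg (by omega), if_neg (by omega)]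
  have heq : ∀ x : Fin n, (x : ℕ) = e → (ρ (σ x) : ℕ) = d := by
    intro x hx
    have : (σ x : ℕ) = d := by rw [hσ, if_pos hx]
    rw [hρd _ this, this]
  have hge : ∀ x : Fin n, e < (x : ℕ) → ρ (σ x) ≤ σ x := by
    intro x hx
    by_contra! h
    have h1 := hρE _ h
    rw [hσ] at h1
    split_ifs at h1 <;> omega
  have hgt : ∀ x : Fin n, e < (x : ℕ) → ρ (σ x) ≤ x := by
    intro x hx
    refine (hge x hx).trans ?_
    rw [Fin.le_def, hσ]
    split_ifs <;> omega
  have hexc : ∀ x, x < ρ (σ x) ↔ (x : ℕ) ∈ excedancePositions P := by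
    intro x
    rw [hE]
    rcases lt_trichotomy (x : ℕ) e with h | h | h
    · rw [hlt x h, hρ.lt_apply_iff]
      simp [h.ne]
    · simp only [h, true_or, iff_true]
      rw [Fin.lt_def, heq x h]
      omega
    · have h1 := hgt x h
      have h2 : (x : ℕ) ∉ excedancePositions (removeStrip P) := fun h' => by
        have := hE' _ h'
        omega
      simp [h.ne', h2, h1]
  have hcases : ∀ x, x < ρ (σ x) → (x : ℕ) = e ∨ ((x : ℕ) < e ∧ x < ρ x ∧ ρ (σ x) = ρ x) := by
    intro x hx
    rcases lt_trichotomy (x : ℕ) e with h | h | h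
    · exact Or.inr ⟨h, by rwa [hlt x h] at hx, hlt x h⟩
    · exact Or.inl h
    · exact absurd hx (not_lt.2 (hgt x h))
  have hσnon : ∀ x, ρ (σ x) ≤ x → (x : ℕ) ≠ e ∧ ρ (σ x) ≤ σ x := by
    intro x hx
    rcases lt_trichotomy (x : ℕ) e with h | h | h
    · refine ⟨h.ne, hx.trans ?_⟩
      rw [Fin.le_def, hσ, if_neg (by omega), if_neg (by omega)]
    · rw [Fin.le_def, heq x h] at hx
      omega
    · exact ⟨h.ne', hge x h⟩
  refine ⟨hexc, fun v => ?_, ?_, ?_, fun x => ?_⟩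
  · rw [hQD, hρ.down_iff]
    constructor
    · rintro (rfl | ⟨x, hx, rfl⟩)
      · exact ⟨⟨e, by omega⟩, (hexc _).2 ((hE _).2 (Or.inl rfl)), heq _ rfl⟩
      · have h := hlt x (hρE x hx)
        exact ⟨x, by rwa [hπ, h], by rw [hπ, h]⟩
    · rintro ⟨x, hx, rfl⟩
      rcases hcases x hx with h | ⟨-, h1, h2⟩
      · exact Or.inl (heq x h)
      · exact Or.inr ⟨x, h1, by rw [hπ, h2]⟩
  · intro x hx y hy hxy
    rw [hπ, hπ]
    have hxy' : (x : ℕ) < y := hxy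
    rcases hcases x hx with h | ⟨h, h1, h2⟩
    · rcases hcases y hy with h' | ⟨h', -⟩ <;> omega
    · rcases hcases y hy with h' | ⟨-, h3, h4⟩
      · rw [h2, Fin.lt_def, heq y h']
        exact hQD' _ ((hρ.down_iff _).2 ⟨x, h1, rfl⟩)
      · rw [h2, h4]
        exact hρ.strictMonoOn_excedances h1 h3 hxy
  · intro x hx y hy hxy
    have hxy' : (x : ℕ) < y := hxy
    obtain ⟨h1, h2⟩ := hσnon x hx
    obtain ⟨h3, h4⟩ := hσnon y hy
    refine hρ.strictMonoOn_nonexcedances h2 h4 ?_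
    rw [Fin.lt_def, hσ, hσ, if_neg h1, if_neg h3]
    split_ifs <;> omega
  · rw [hG x x.2, ← hρ.apply_eq_iff, hπ]
    by_cases h : (x : ℕ) < e ∨ d < (x : ℕ)
    · have h1 : σ x = x := by
        ext
        rw [hσ, if_neg (by omega), if_neg (by omega)]
      rw [h1]
      exact ⟨fun h2 => ⟨h2, by omega⟩, fun h2 => h2.1⟩
    · refine iff_of_false (fun h1 => ?_) (by omega)
      rcases eq_or_ne (x : ℕ) e with h2 | h2
      · have := heq x h2
        rw [h1] at this
        omega
      · have := hge x (by omega)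
        rw [h1, Fin.le_def, hσ, if_neg h2, if_pos (by omega)] at this
        omega

theorem isPermOf_phi {n : ℕ} {P : List Step} (hP : P ∈ motzkinPaths n) : IsPermOf P (phi n P) := by
  rw [phi, stripDecomposition]
  generalize hk : P.count Step.U = k
  induction k generalizing P with
  | zero => simpa [stripParams] using isPermOf_one hP hk
  | succ k ih =>
    have hU : 0 < P.count Step.U := by omega
    have := count_removeStrip hP hU
    rw [stripParams, List.map_append, List.prod_append]
    simpa using (ih (removeStrip_mem_motzkinPaths hP hU) (by omega)).mul_stripPerm hP hU

/-! ### Excedances of permutations -/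

theorem exists_gt_apply_lt {n : ℕ} {π : Equiv.Perm (Fin n)} {y : Fin n} (hy : y < π y) :
    ∃ z, y < z ∧ π z < π y := by
  by_contra! H
  have h : (Finset.Iio (π y)).image π.symm ⊆ Finset.Iio y := by
    intro z hz
    simp only [Finset.mem_image, Finset.mem_Iio] at hz ⊢
    obtain ⟨v, hv, rfl⟩ := hz
    rcases lt_trichotomy (π.symm v) y with h | h | h
    · exact h
    · simp [← h] at hv
    · have := H _ h
      simp only [Equiv.apply_symm_apply] at this
      exact absurd hv (not_lt.2 this)
  have := Finset.card_le_card h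
  rw [Finset.card_image_of_injective _ π.symm.injective, Fin.card_Iio, Fin.card_Iio] at this
  exact absurd hy (not_lt.2 this)

theorem exists_lt_lt_apply {n : ℕ} {π : Equiv.Perm (Fin n)} {x y : Fin n} (hx : π x ≤ x)
    (hxy : x < y) (h : π y < π x) : ∃ z, z < x ∧ π x < π z := by
  by_contra! H
  have hsub : (insert y (Finset.Iio x)).image π ⊆ Finset.Iio (π x) := by
    intro v hv
    simp only [Finset.mem_image, Finset.mem_insert, Finset.mem_Iio] at hv ⊢
    obtain ⟨z, rfl | hz, rfl⟩ := hv
    · exact h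
    · exact lt_of_le_of_ne (H z hz) (π.injective.ne hz.ne)
  have := Finset.card_le_card hsub
  rw [Finset.card_image_of_injective _ π.injective, Finset.card_insert_of_notMem (by simp [hxy.le]),
    Fin.card_Iio, Fin.card_Iio] at this
  rw [Fin.le_def] at hx
  omega

theorem Avoids321.strictMonoOn_excedances {n : ℕ} {π : Equiv.Perm (Fin n)} (h : Avoids321 π) :
    StrictMonoOn π {x | x < π x} := by
  intro x _ y hy hxy
  by_contra! hlt
  obtain ⟨z, hz, hz'⟩ := exists_gt_apply_lt hy
  exact h ⟨x, y, z, hxy, hz, lt_of_le_of_ne hlt (π.injective.ne hxy.ne'), hz'⟩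

theorem Avoids321.strictMonoOn_nonexcedances {n : ℕ} {π : Equiv.Perm (Fin n)} (h : Avoids321 π) :
    StrictMonoOn π {x | π x ≤ x} := by
  intro x hx y _ hxy
  by_contra! hle
  have hlt := lt_of_le_of_ne hle (π.injective.ne hxy.ne')
  obtain ⟨z, hz, hz'⟩ := exists_lt_lt_apply hx hxy hlt
  exact h ⟨z, x, y, hz, hxy, hz', hlt⟩

theorem avoids321_of_strictMonoOn {n : ℕ} {π : Equiv.Perm (Fin n)}
    (h1 : StrictMonoOn π {x | x < π x}) (h2 : StrictMonoOn π {x | π x ≤ x}) : Avoids321 π := by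
  rintro ⟨i, j, k, hij, hjk, h3, h4⟩
  rcases lt_or_ge i (π i) with hi | hi <;> rcases lt_or_ge j (π j) with hj | hj <;>
    rcases lt_or_ge k (π k) with hk | hk
  · exact (h1 hi hj hij).not_gt h3
  · exact (h1 hi hj hij).not_gt h3
  · exact (h1 hi hk (hij.trans hjk)).not_gt (h4.trans h3)
  · exact (h2 hj hk hjk).not_gt h4
  · exact (h1 hj hk hjk).not_gt h4
  · exact (h2 hi hk (hij.trans hjk)).not_gt (h4.trans h3)
  · exact (h2 hi hj hij).not_gt h3
  · exact (h2 hi hj hij).not_gt h3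

theorem avoids3bar142_of_strictMonoOn {n : ℕ} {π : Equiv.Perm (Fin n)}
    (h1 : StrictMonoOn π {x | x < π x}) (h2 : StrictMonoOn π {x | π x ≤ x})
    (h3 : ∀ x y : Fin n, (y : ℕ) = x + 1 → x < π x → π y ≤ y) : Avoids3bar142 π := by
  intro i j k hij hjk hji hik
  have hi : i < π i := by
    by_contra! hi
    rcases lt_or_ge k (π k) with hk | hk
    · exact absurd ((hij.trans hjk).trans hk) (not_lt.2 (hik.le.trans hi))
    · exact (h2 hi hk (hij.trans hjk)).not_gt hik
  have hk : π k ≤ k := by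
    by_contra! hk
    exact (h1 hi hk (hij.trans hjk)).not_gt hik
  have hj : j < π j := by
    by_contra! hj
    exact (h2 hj hk hjk).not_gt (hik.trans hji)
  obtain ⟨m, hm⟩ : ∃ m : Fin n, (m : ℕ) = i + 1 := ⟨⟨i + 1, by omega⟩, rfl⟩
  have hmn := h3 i m hm hi
  have hmj : m ≠ j := by
    rintro rfl
    exact absurd hj (not_lt.2 hmn)
  have hmj' : m < j := by omega
  exact ⟨m, by omega, hmj', h2 hmn hk (hmj'.trans hjk)⟩

theorem apply_le_of_mem_avoidingPerms {n : ℕ} {π : Equiv.Perm (Fin n)} (hπ : π ∈ avoidingPerms n)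
    {x y : Fin n} (hxy : (y : ℕ) = x + 1) (hx : x < π x) : π y ≤ y := by
  by_contra! hy
  have hlt : x < y := by omega
  obtain ⟨z, hz, hz'⟩ := exists_gt_apply_lt hx
  have hyx := hπ.1.strictMonoOn_excedances hx hy hlt
  have hzy : z ≠ y := by
    rintro rfl
    exact hz'.not_gt hyx
  obtain ⟨m, hm, hm', -⟩ := hπ.2 x y z hlt (by omega) hyx hz'
  omega

theorem eqOn_of_strictMonoOn {n : ℕ} {s : Set (Fin n)} {f g : Fin n → Fin n}
    (hf : StrictMonoOn f s) (hg : StrictMonoOn g s) (h : f '' s = g '' s) : Set.EqOn f g s := by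
  have key : (fun x : s => f x) = fun x : s => g x := by
    have hf' : StrictMono fun x : s => f x := fun x y hxy => hf x.2 y.2 hxy
    have hg' : StrictMono fun x : s => g x := fun x y hxy => hg x.2 y.2 hxy
    refine (StrictMono.range_inj hf' hg').1 ?_
    rw [Set.image_eq_range, Set.image_eq_range] at h
    exact h
  exact fun x hx => congrFun key ⟨x, hx⟩

theorem perm_eq_of_excedances {n : ℕ} {π ρ : Equiv.Perm (Fin n)}
    (hπ1 : StrictMonoOn π {x | x < π x}) (hπ2 : StrictMonoOn π {x | π x ≤ x})
    (hρ1 : StrictMonoOn ρ {x | x < ρ x}) (hρ2 : StrictMonoOn ρ {x | ρ x ≤ x})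
    (hpos : ∀ x, x < π x ↔ x < ρ x) (hval : π '' {x | x < π x} = ρ '' {x | x < ρ x}) : π = ρ := by
  have hs : {x | x < ρ x} = {x | x < π x} := by
    ext x
    exact (hpos x).symm
  have hc : ∀ τ : Equiv.Perm (Fin n), {x | τ x ≤ x} = {x | x < τ x}ᶜ := fun τ => by
    ext x
    simp
  rw [hc] at hπ2 hρ2
  rw [hs] at hρ1 hρ2 hval
  have e1 := eqOn_of_strictMonoOn hπ1 hρ1 hval
  have e2 := eqOn_of_strictMonoOn hπ2 hρ2
    (by rw [Set.image_compl_eq π.bijective, Set.image_compl_eq ρ.bijective, hval])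
  ext x
  by_cases hx : x < π x
  · rw [e1 hx]
  · rw [e2 hx]

/-! ### The map `φ` is injective -/

theorem excedancePositions_add_one_notMem {P : List Step} {e : ℕ}
    (he : e ∈ excedancePositions P) : e + 1 ∉ excedancePositions P := by
  rintro ⟨v, hv, hv'⟩
  obtain ⟨u, hu, hu'⟩ := he
  have hun := (List.getElem?_eq_some_iff.1 hu).1
  have hvn := (List.getElem?_eq_some_iff.1 hv).1
  have hu1 := height_succ hu
  have hv1 := height_succ hv
  simp only [Step.rise] at hu1 hv1
  push_cast at hv'
  rcases lt_trichotomy u v with h | rfl | h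
  · have := add_height_le (P := P) (i := u + 1) (j := v) h hvn.le
    push_cast at this
    omega
  · omega
  · have := add_height_le (P := P) (i := v + 1) (j := u) h hun.le
    push_cast at this
    omega

theorem lt_of_mem_excedancePositions {n : ℕ} {P : List Step} (hP : P ∈ motzkinPaths n) {e : ℕ}
    (he : e ∈ excedancePositions P) : e < n := by
  obtain ⟨u, hu, hu'⟩ := he
  have hun := (List.getElem?_eq_some_iff.1 hu).1
  have hu1 := height_succ hu
  have h := add_height_le (P := P) (i := u + 1) (j := n) (by rw [← hP.1]; exact hun) hP.1.ge
  rw [hP.2.1] at h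
  simp only [Step.rise] at hu1
  push_cast at h
  omega

theorem height_congr {P P' : List Step} {i : ℕ} (h : ∀ j < i, P[j]? = P'[j]?) :
    height P i = height P' i := by
  have : P.take i = P'.take i := by
    apply List.ext_getElem?
    intro j
    rw [List.getElem?_take, List.getElem?_take]
    split_ifs with hj
    · exact h j hj
    · rfl
  rw [height, height, this]

theorem getElem?_eq_U {P P' : List Step} {i : ℕ}
    (hE : ∀ e, e ∈ excedancePositions P → e ∈ excedancePositions P')
    (hnn : 0 ≤ height P i) (hlen : i < P'.length)
    (hD : P'[i]? = some Step.D → P[i]? = some Step.D) (hh : height P i = height P' i)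
    (hi : P[i]? = some Step.U) : P'[i]? = some Step.U := by
  obtain ⟨e, he⟩ : ∃ e : ℕ, (e : ℤ) = i + height P i :=
    ⟨_, Int.toNat_of_nonneg (by omega)⟩
  obtain ⟨v, hv, hv'⟩ := hE e ⟨i, hi, he⟩
  have hvn := (List.getElem?_eq_some_iff.1 hv).1
  have hv1 := height_succ hv
  simp only [Step.rise] at hv1
  rcases lt_trichotomy v i with h | rfl | h
  · have := add_height_le (P := P') (i := v + 1) (j := i) h hlen.le
    push_cast at this
    omega
  · exact hv
  · have h1 := add_height_le (P := P') (i := i + 1) (j := v) h hvn.le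
    obtain ⟨s, hs⟩ : ∃ s, P'[i]? = some s := ⟨_, List.getElem?_eq_getElem hlen⟩
    have h2 := height_succ hs
    push_cast at h1
    cases s with
    | U => exact hs
    | D => simp [hD hs] at hi
    | H =>
      simp only [Step.rise] at h2
      omega

theorem IsPermOf.path_eq {n : ℕ} {P P' : List Step} {π : Equiv.Perm (Fin n)}
    (hP : P ∈ motzkinPaths n) (hP' : P' ∈ motzkinPaths n) (h : IsPermOf P π)
    (h' : IsPermOf P' π) : P = P' := by
  have hE : ∀ e, e ∈ excedancePositions P ↔ e ∈ excedancePositions P' := by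
    intro e
    by_cases he : e < n
    · exact (h.lt_apply_iff ⟨e, he⟩).symm.trans (h'.lt_apply_iff ⟨e, he⟩)
    · exact iff_of_false (fun H => he (lt_of_mem_excedancePositions hP H))
        (fun H => he (lt_of_mem_excedancePositions hP' H))
  have hD : ∀ v, P[v]? = some Step.D ↔ P'[v]? = some Step.D := fun v =>
    (h.down_iff v).trans (h'.down_iff v).symm
  apply List.ext_getElem?
  intro i
  induction i using Nat.strong_induction_on with
  | _ i ih =>
    have hh := height_congr ih
    by_cases hi : i < n
    · have hiP : i < P.length := by rwa [hP.1]
      have hiP' : i < P'.length := by rwa [hP'.1]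
      have hU : P[i]? = some Step.U ↔ P'[i]? = some Step.U :=
        ⟨getElem?_eq_U (fun e => (hE e).1) (hP.2.2 i hi.le) hiP' (hD i).2 hh,
          getElem?_eq_U (fun e => (hE e).2) (hP'.2.2 i hi.le) hiP (hD i).1 hh.symm⟩
      have hDi := hD i
      rw [List.getElem?_eq_getElem hiP, List.getElem?_eq_getElem hiP'] at hU hDi ⊢
      cases hs : P[i] <;> cases hs' : P'[i] <;> simp_all
    · rw [List.getElem?_eq_none (by rw [hP.1]; omega), List.getElem?_eq_none (by rw [hP'.1]; omega)]

/-! ### The map `φ` is onto -/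

open Classical in
/-- The step number `i`, starting at height `h`, of the Motzkin path that belongs to `π`. -/
noncomputable def greedyStep {n : ℕ} (π : Equiv.Perm (Fin n)) (i : ℕ) (h : ℤ) : Step :=
  if ∃ x, x < π x ∧ (π x : ℕ) = i then Step.D
  else if ∃ x, x < π x ∧ ((x : ℕ) : ℤ) = i + h then Step.U
  else Step.H

/-- The heights of the Motzkin path that belongs to `π`. -/
noncomputable def greedyHeight {n : ℕ} (π : Equiv.Perm (Fin n)) : ℕ → ℤ
  | 0 => 0
  | i + 1 => greedyHeight π i + (greedyStep π i (greedyHeight π i)).rise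

/-- The Motzkin path that belongs to `π`. -/
noncomputable def greedyPath {n : ℕ} (π : Equiv.Perm (Fin n)) : List Step :=
  (List.range n).map fun i => greedyStep π i (greedyHeight π i)

theorem getElem?_greedyPath {n : ℕ} (π : Equiv.Perm (Fin n)) {i : ℕ} (hi : i < n) :
    (greedyPath π)[i]? = some (greedyStep π i (greedyHeight π i)) := by
  simp [greedyPath, hi]

theorem height_greedyPath {n : ℕ} (π : Equiv.Perm (Fin n)) {i : ℕ} (hi : i ≤ n) :
    height (greedyPath π) i = greedyHeight π i := by
  induction i with
  | zero => simp [greedyHeight]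
  | succ i ih => rw [height_succ (getElem?_greedyPath π hi), ih (by omega), greedyHeight]

theorem greedyStep_cases {n : ℕ} (π : Equiv.Perm (Fin n)) (i : ℕ) (h : ℤ) :
    ((∃ x, x < π x ∧ (π x : ℕ) = i) ∧ greedyStep π i h = Step.D) ∨
    ((∀ x, x < π x → (π x : ℕ) ≠ i) ∧ (∃ x, x < π x ∧ ((x : ℕ) : ℤ) = i + h) ∧
      greedyStep π i h = Step.U) ∨
    ((∀ x, x < π x → (π x : ℕ) ≠ i) ∧ (∀ x, x < π x → ((x : ℕ) : ℤ) ≠ i + h) ∧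
      greedyStep π i h = Step.H) := by
  unfold greedyStep
  split_ifs with h1 h2
  · exact Or.inl ⟨h1, rfl⟩
  · push Not at h1
    exact Or.inr (Or.inl ⟨h1, h2, rfl⟩)
  · push Not at h1 h2
    exact Or.inr (Or.inr ⟨h1, h2, rfl⟩)

theorem greedyHeight_eq {n : ℕ} {π : Equiv.Perm (Fin n)} (hπ : π ∈ avoidingPerms n) (i : ℕ) :
    greedyHeight π i =
      (Finset.univ.filter fun x => x < π x ∧ ((x : ℕ) : ℤ) < i + greedyHeight π i).card -
      ((Finset.univ.filter fun x => x < π x ∧ (π x : ℕ) < i).card : ℤ) := by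
  induction i with
  | zero =>
    have : ∀ x : Fin n, ¬ ((x : ℕ) : ℤ) < 0 := fun x => by omega
    simp [greedyHeight, this]
  | succ i ih =>
    rw [greedyHeight]
    set h := greedyHeight π i
    rcases greedyStep_cases π i h with ⟨⟨x, hx, hxi⟩, hs⟩ | ⟨h1, ⟨x, hx, hxi⟩, hs⟩ | ⟨h1, h2, hs⟩
    · rw [hs]
      have e1 : (Finset.univ.filter fun y => y < π y ∧
          ((y : ℕ) : ℤ) < (i + 1 : ℕ) + (h + Step.D.rise)) =
          Finset.univ.filter fun y => y < π y ∧ ((y : ℕ) : ℤ) < i + h := by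
        ext y
        simp only [Finset.mem_filter, Finset.mem_univ, true_and]
        simp only [Step.rise]
        push_cast
        refine and_congr_right fun _ => ?_
        omega
      have e2 : (Finset.univ.filter fun y => y < π y ∧ (π y : ℕ) < i + 1) =
          insert x (Finset.univ.filter fun y => y < π y ∧ (π y : ℕ) < i) := by
        ext y
        simp only [Finset.mem_filter, Finset.mem_univ, true_and, Finset.mem_insert]
        constructor
        · rintro ⟨h1, h2⟩
          by_cases h3 : (π y : ℕ) = i
          · exact Or.inl (π.injective (Fin.ext (h3.trans hxi.symm)))
          · exact Or.inr ⟨h1, by omega⟩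
        · rintro (rfl | ⟨h1, h2⟩)
          · exact ⟨hx, by omega⟩
          · exact ⟨h1, by omega⟩
      rw [e1, e2, Finset.card_insert_of_notMem (by simp [hxi])]
      simp only [Step.rise]
      push_cast
      omega
    · rw [hs]
      have e1 : (Finset.univ.filter fun y => y < π y ∧
          ((y : ℕ) : ℤ) < (i + 1 : ℕ) + (h + Step.U.rise)) =
          insert x (Finset.univ.filter fun y => y < π y ∧ ((y : ℕ) : ℤ) < i + h) := by
        ext y
        simp only [Finset.mem_filter, Finset.mem_univ, true_and, Finset.mem_insert]
        simp only [Step.rise]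
        push_cast
        constructor
        · rintro ⟨h2, h3⟩
          by_cases h4 : (y : ℕ) = x
          · exact Or.inl (Fin.ext h4)
          · refine Or.inr ⟨h2, ?_⟩
            by_contra h5
            exact absurd h2 (not_lt.2 (apply_le_of_mem_avoidingPerms hπ (x := x) (by omega) hx))
        · rintro (rfl | ⟨h2, h3⟩)
          · exact ⟨hx, by omega⟩
          · exact ⟨h2, by omega⟩
      have e2 : (Finset.univ.filter fun y => y < π y ∧ (π y : ℕ) < i + 1) =
          Finset.univ.filter fun y => y < π y ∧ (π y : ℕ) < i := by
        ext y
        simp only [Finset.mem_filter, Finset.mem_univ, true_and]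
        refine and_congr_right fun h2 => ?_
        have := h1 y h2
        omega
      rw [e1, e2, Finset.card_insert_of_notMem (by simp [hxi])]
      simp only [Step.rise]
      push_cast
      omega
    · rw [hs]
      have e1 : (Finset.univ.filter fun y => y < π y ∧
          ((y : ℕ) : ℤ) < (i + 1 : ℕ) + (h + Step.H.rise)) =
          Finset.univ.filter fun y => y < π y ∧ ((y : ℕ) : ℤ) < i + h := by
        ext y
        simp only [Finset.mem_filter, Finset.mem_univ, true_and]
        simp only [Step.rise]
        push_cast
        refine and_congr_right fun h3 => ?_
        have := h2 y h3
        omega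
      have e2 : (Finset.univ.filter fun y => y < π y ∧ (π y : ℕ) < i + 1) =
          Finset.univ.filter fun y => y < π y ∧ (π y : ℕ) < i := by
        ext y
        simp only [Finset.mem_filter, Finset.mem_univ, true_and]
        refine and_congr_right fun h2 => ?_
        have := h1 y h2
        omega
      rw [e1, e2]
      simp only [Step.rise]
      omega

theorem greedyHeight_nonneg {n : ℕ} {π : Equiv.Perm (Fin n)} (hπ : π ∈ avoidingPerms n) (i : ℕ) :
    0 ≤ greedyHeight π i := by
  induction i with
  | zero => exact le_rfl
  | succ i ih =>
    have h1 := greedyHeight_eq hπ (i + 1)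
    have h2 : -1 ≤ greedyHeight π (i + 1) := by
      rw [greedyHeight]
      cases greedyStep π i (greedyHeight π i) <;> simp only [Step.rise] <;> omega
    have h3 : (Finset.univ.filter fun x => x < π x ∧ (π x : ℕ) < i + 1) ⊆
        Finset.univ.filter fun x => x < π x ∧
          ((x : ℕ) : ℤ) < (i + 1 : ℕ) + greedyHeight π (i + 1) := by
      intro x
      simp only [Finset.mem_filter, Finset.mem_univ, true_and]
      rintro ⟨h4, h5⟩
      exact ⟨h4, by omega⟩
    have := Finset.card_le_card h3
    omega

theorem greedyHeight_last {n : ℕ} {π : Equiv.Perm (Fin n)} (hπ : π ∈ avoidingPerms n) :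
    greedyHeight π n = 0 := by
  have h1 := greedyHeight_eq hπ n
  have h2 := greedyHeight_nonneg hπ n
  rw [h1, sub_eq_zero, Nat.cast_inj]
  congr 1
  ext x
  simp only [Finset.mem_filter, Finset.mem_univ, true_and]
  refine and_congr_right fun _ => ?_
  omega

theorem greedyPath_mem_motzkinPaths {n : ℕ} {π : Equiv.Perm (Fin n)} (hπ : π ∈ avoidingPerms n) :
    greedyPath π ∈ motzkinPaths n := by
  refine ⟨by simp [greedyPath], ?_, fun i hi => ?_⟩
  · rw [height_greedyPath π le_rfl, greedyHeight_last hπ]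
  · rw [height_greedyPath π hi]
    exact greedyHeight_nonneg hπ i

theorem exists_greedyStep_eq_U {n : ℕ} {π : Equiv.Perm (Fin n)} (hπ : π ∈ avoidingPerms n) (i : ℕ)
    {x : Fin n} (hx : x < π x) (hxi : ((x : ℕ) : ℤ) < i + greedyHeight π i) :
    ∃ u < i, greedyStep π u (greedyHeight π u) = Step.U ∧
      ((x : ℕ) : ℤ) = u + greedyHeight π u := by
  induction i with
  | zero =>
    simp only [greedyHeight] at hxi
    omega
  | succ i ih =>
    by_cases hlt : ((x : ℕ) : ℤ) < i + greedyHeight π i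
    · obtain ⟨u, hu, h⟩ := ih hlt
      exact ⟨u, by omega, h⟩
    rw [greedyHeight] at hxi
    push_cast at hxi
    rcases greedyStep_cases π i (greedyHeight π i) with
      ⟨-, hs⟩ | ⟨h1, ⟨y, hy, hyi⟩, hs⟩ | ⟨h1, h2, hs⟩
    · rw [hs] at hxi
      simp only [Step.rise] at hxi
      omega
    · refine ⟨i, by omega, hs, ?_⟩
      rw [hs] at hxi
      simp only [Step.rise] at hxi
      by_contra h3
      exact absurd hx (not_lt.2 (apply_le_of_mem_avoidingPerms hπ (x := y) (by omega) hy))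
    · rw [hs] at hxi
      simp only [Step.rise] at hxi
      have := h2 x hx
      omega

theorem mem_excedancePositions_greedyPath {n : ℕ} {π : Equiv.Perm (Fin n)}
    (hπ : π ∈ avoidingPerms n) (x : Fin n) :
    (x : ℕ) ∈ excedancePositions (greedyPath π) ↔ x < π x := by
  constructor
  · rintro ⟨u, hu, hxu⟩
    have hun : u < n := by
      have := (List.getElem?_eq_some_iff.1 hu).1
      rwa [(greedyPath_mem_motzkinPaths hπ).1] at this
    rw [getElem?_greedyPath π hun, Option.some.injEq] at hu
    rw [height_greedyPath π hun.le] at hxu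
    rcases greedyStep_cases π u (greedyHeight π u) with
      ⟨-, hs⟩ | ⟨-, ⟨y, hy, hyi⟩, -⟩ | ⟨-, -, hs⟩
    · simp [hs] at hu
    · obtain rfl : x = y := by
        ext
        omega
      exact hy
    · simp [hs] at hu
  · intro hx
    obtain ⟨u, hu, hs, h⟩ := exists_greedyStep_eq_U hπ n hx
      (by rw [greedyHeight_last hπ]; omega)
    exact ⟨u, by rw [getElem?_greedyPath π hu, hs], by rw [height_greedyPath π hu.le, h]⟩

theorem getElem?_greedyPath_eq_D_iff {n : ℕ} (π : Equiv.Perm (Fin n)) (v : Fin n) :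
    (greedyPath π)[(v : ℕ)]? = some Step.D ↔ ∃ x, x < π x ∧ (π x : ℕ) = v := by
  rw [getElem?_greedyPath π v.2, Option.some.injEq]
  rcases greedyStep_cases π v (greedyHeight π v) with ⟨h, hs⟩ | ⟨h, -, hs⟩ | ⟨h, -, hs⟩
  · exact iff_of_true hs h
  · exact iff_of_false (by simp [hs]) (by push Not; exact h)
  · exact iff_of_false (by simp [hs]) (by push Not; exact h)

theorem phi_greedyPath {n : ℕ} {π : Equiv.Perm (Fin n)} (hπ : π ∈ avoidingPerms n) :
    phi n (greedyPath π) = π := by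
  have h := isPermOf_phi (greedyPath_mem_motzkinPaths hπ)
  refine perm_eq_of_excedances h.strictMonoOn_excedances h.strictMonoOn_nonexcedances
    hπ.1.strictMonoOn_excedances hπ.1.strictMonoOn_nonexcedances
    (fun x => (h.lt_apply_iff x).trans (mem_excedancePositions_greedyPath hπ x)) ?_
  ext v : 1
  have := (h.down_iff v).symm.trans (getElem?_greedyPath_eq_D_iff π v)
  simp only [Fin.val_inj] at this
  exact this

/-! ### The bijections -/

theorem phi_mem_avoidingPerms {n : ℕ} {P : List Step} (hP : P ∈ motzkinPaths n) :
    phi n P ∈ avoidingPerms n := by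
  have h := isPermOf_phi hP
  refine ⟨avoids321_of_strictMonoOn h.strictMonoOn_excedances h.strictMonoOn_nonexcedances,
    avoids3bar142_of_strictMonoOn h.strictMonoOn_excedances h.strictMonoOn_nonexcedances
      fun x y hxy hx => ?_⟩
  by_contra! hy
  rw [h.lt_apply_iff] at hx hy
  rw [hxy] at hy
  exact excedancePositions_add_one_notMem hx hy

theorem bijOn_phi (n : ℕ) : Set.BijOn (phi n) (motzkinPaths n) (avoidingPerms n) := by
  refine ⟨fun P hP => phi_mem_avoidingPerms hP, fun P hP P' hP' h => ?_, fun π hπ => ?_⟩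
  · have h1 := isPermOf_phi hP
    rw [h] at h1
    exact h1.path_eq hP hP' (isPermOf_phi hP')
  · exact ⟨greedyPath π, greedyPath_mem_motzkinPaths hπ, phi_greedyPath hπ⟩

theorem phi_mem_derangements_iff {n : ℕ} {P : List Step} (hP : P ∈ motzkinPaths n) :
    phi n P ∈ derangements (Fin n) ↔ P ∈ riordanPaths n := by
  have h := (isPermOf_phi hP).apply_eq_iff
  constructor
  · refine fun hd => ⟨hP, fun i hi h0 => ?_⟩
    have hin : i < n := by
      have := (List.getElem?_eq_some_iff.1 hi).1
      rwa [hP.1] at this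
    exact hd ⟨i, hin⟩ ((h ⟨i, hin⟩).2 ⟨hi, h0⟩)
  · intro hR x hx
    obtain ⟨h1, h2⟩ := (h x).1 hx
    exact hR.2 x h1 h2

theorem bijOn_phi_riordanPaths (n : ℕ) :
    Set.BijOn (phi n) (riordanPaths n) (avoidingDerangements n) := by
  have hsub : riordanPaths n ⊆ motzkinPaths n := fun P hP => hP.1
  refine ⟨fun P hP => ⟨phi_mem_avoidingPerms hP.1, (phi_mem_derangements_iff hP.1).2 hP⟩,
    (bijOn_phi n).injOn.mono hsub, fun π hπ => ?_⟩
  obtain ⟨P, hP, rfl⟩ := (bijOn_phi n).surjOn hπ.1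
  exact ⟨P, (phi_mem_derangements_iff hP).1 hπ.2, rfl⟩

end RiordanDerangement

/-- The map `φ` is a bijection from the Motzkin paths of length `n` onto `S_n(321, 3 1̄ 4 2)`, and it
restricts to a bijection from the Riordan paths of length `n` onto `D_n(321, 3 1̄ 4 2)`;
the number of these derangements is the Riordan number `r_n`. -/
theorem mainTheorem1 (n : ℕ) :
    Set.BijOn (RiordanDerangement.phi n) (RiordanDerangement.motzkinPaths n)
      (RiordanDerangement.avoidingPerms n) ∧
    Set.BijOn (RiordanDerangement.phi n) (RiordanDerangement.riordanPaths n)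
      (RiordanDerangement.avoidingDerangements n) ∧
    (RiordanDerangement.avoidingDerangements n).ncard = RiordanDerangement.riordanNumber n := by
  have h := RiordanDerangement.bijOn_phi_riordanPaths n
  refine ⟨RiordanDerangement.bijOn_phi n, h, ?_⟩
  rw [← RiordanDerangement.ncard_riordanPaths, ← h.image_eq, h.injOn.ncard_image]
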